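/- Let $n, r$ be integers with $1 \le r < n/2$. Let $\mathcal{H}$ be the space of real symmetric $n\times n$ matrices with the Frobenius inner product $\langle A,B\rangle = \mathrm{tr}(A^{T}B)$ and norm $\|\cdot\|_{\mathcal H}=\|\cdot\|_F$, and let $\Sigma=\Sigma_r\subset\mathcal{H}$ be the set of symmetric matrices of rank at most $r$. Let $\mathcal{C}$ be the set of all functions $R:\mathcal{H}\to\mathbb{R}$ that are convex, continuous and coercive ($R(x)\to+\infty$ as $\|x\|_{\mathcal H}\to\infty$). For $R\in\mathcal{C}$ put $$\mathcal{T}_R(\Sigma)=\bigcup_{x\in\Sigma}\{\gamma z:\ \gamma\in\mathbb{R},\ z\in\mathcal{H},\ R(x+z)\le R(x)\},$$ $$\|x\|_\Sigma=\inf\{t\ge 0:\ x\in t\cdot\overline{\mathrm{conv}}(\{u\in\Sigma:\|u\|_{\mathcal H}=1\})\},$$ $$\delta^{\mathtt{suff}}_\Sigma(R)=\inf_{z\in\mathcal{T}_R(\Sigma)\setminus\{0\}}\ \sup_{x\in\Sigma\setminus\{0\}}\ \frac{-\langle x,z\rangle}{\|x\|_{\mathcal H}\sqrt{\|x+z\|_\Sigma^2-\|x\|_{\mathcal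 H}^2-2\langle x,z\rangle}}.$$ Let $R^\star=\|\cdot\|_*$ be the nuclear norm (the sum of the absolute values of the eigenvalues, with multiplicity). Then $R^\star\in\mathcal{C}$ and $$\delta^{\mathtt{suff}}_\Sigma(R^\star)=\sup_{R\in\mathcal{C}}\delta^{\mathtt{suff}}_\Sigma(R)=\frac{1}{\sqrt2}.$$ -/

import Mathlib

open Set Filter
open scoped NNReal ENNReal Pointwise InnerProductSpace

noncomputable section

/-! ### Regularizers, descent cones, atomic norms and the sufficient RIP constant -/

/-- The class of coercive continuous convex (everywhere finite) regularizers on `H`;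
coercive means `R x → +∞` as `‖x‖ → +∞`. -/
def regularizers (H : Type*) [NormedAddCommGroup H] [NormedSpace ℝ H] : Set (H → ℝ) :=
  {R | ConvexOn ℝ univ R ∧ Continuous R ∧ Tendsto R (Bornology.cobounded H) atTop}

/-- The symmetrized descent cone `{γ z : γ ∈ ℝ, R (x + z) ≤ R x}` of `R` at `x`. -/
def descentConeAt {H : Type*} [AddCommGroup H] [Module ℝ H] (R : H → ℝ) (x : H) : Set H :=
  {y | ∃ (γ : ℝ) (z : H), R (x + z) ≤ R x ∧ y = γ • z}

/-- The union of the symmetrized descent cones of `R` at the points of the model set `S`. -/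
def descentCone {H : Type*} [AddCommGroup H] [Module ℝ H] (R : H → ℝ) (S : Set H) : Set H :=
  ⋃ x ∈ S, descentConeAt R x

/-- The atomic "norm" `inf {t ≥ 0 : x ∈ t • closure (conv A)}`, which is `∞` when there is no
such `t`. -/
def atomicNorm {H : Type*} [NormedAddCommGroup H] [NormedSpace ℝ H] (A : Set H) (x : H) : ℝ≥0∞ :=
  ⨅ (t : ℝ≥0) (_ : x ∈ (t : ℝ) • closure (convexHull ℝ A)), (t : ℝ≥0∞)

/-- The atomic norm induced by a model set `S`: its atoms are the unit vectors of `S`. -/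
def modelNorm {H : Type*} [NormedAddCommGroup H] [NormedSpace ℝ H] (S : Set H) (x : H) : ℝ≥0∞ :=
  atomicNorm (S ∩ Metric.sphere 0 1) x

/-- The explicit sufficient RIP constant of the model set `S` and the regularizer `R`:
the infimum over nonzero `z` in the descent cone, of the supremum over nonzero `x ∈ S`, of
`-⟪x, z⟫ / (‖x‖ * √(‖x + z‖_S ^ 2 - ‖x‖ ^ 2 - 2 ⟪x, z⟫))`.
It is meant for models whose atomic norm `‖·‖_S` is finite everywhere. The infimum and
the supremum are taken in the extended reals. -/
def suffRIP {H : Type*} [NormedAddCommGroup H] [InnerProductSpace ℝ H]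
    (S : Set H) (R : H → ℝ) : EReal :=
  ⨅ z ∈ descentCone R S \ {0}, ⨆ x ∈ S \ {0},
    ((-⟪x, z⟫_ℝ /
      (‖x‖ * √((modelNorm S (x + z)).toReal ^ 2 - ‖x‖ ^ 2 - 2 * ⟪x, z⟫_ℝ)) : ℝ) : EReal)

/-! ### Symmetric matrices with the Frobenius inner product -/

/-- The real symmetric `n × n` matrices, as a linear subspace of the space of all matrices. -/
def symmetricMatrices (n : ℕ) : Submodule ℝ (Matrix (Fin n) (Fin n) ℝ) where
  carrier := {A | A.IsSymm}
  add_mem' hA hB := Matrix.IsSymm.add hA hB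
  zero_mem' := Matrix.isSymm_zero
  smul_mem' c _ hA := Matrix.IsSymm.smul hA c

/-- The space of real symmetric `n × n` matrices. It is a separate type so that its only norm is
the Frobenius norm given below. -/
def SymMat (n : ℕ) : Type := symmetricMatrices n

namespace SymMat

instance (n : ℕ) : AddCommGroup (SymMat n) := inferInstanceAs (AddCommGroup (symmetricMatrices n))

instance (n : ℕ) : Module ℝ (SymMat n) := inferInstanceAs (Module ℝ (symmetricMatrices n))

instance (n : ℕ) : FiniteDimensional ℝ (SymMat n) :=
  inferInstanceAs (FiniteDimensional ℝ (symmetricMatrices n))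

/-- The matrix underlying an element of `SymMat n`. -/
def toMatrix {n : ℕ} : SymMat n →ₗ[ℝ] Matrix (Fin n) (Fin n) ℝ := (symmetricMatrices n).subtype

/-- A symmetric matrix as an element of `SymMat n`. -/
def ofMatrix {n : ℕ} (A : Matrix (Fin n) (Fin n) ℝ) (hA : A.IsSymm) : SymMat n := ⟨A, hA⟩

theorem toMatrix_ofMatrix {n : ℕ} (A : Matrix (Fin n) (Fin n) ℝ) (hA : A.IsSymm) :
    toMatrix (ofMatrix A hA) = A := rfl

theorem toMatrix_injective {n : ℕ} :
    Function.Injective (toMatrix : SymMat n → Matrix (Fin n) (Fin n) ℝ) :=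
  Subtype.val_injective

theorem isSymm_toMatrix {n : ℕ} (A : SymMat n) : (toMatrix A).IsSymm := A.2

theorem isHermitian_toMatrix {n : ℕ} (A : SymMat n) : (toMatrix A).IsHermitian := A.2

/-- The Frobenius inner product `trace (Aᵀ B)`. -/
@[reducible] def innerCore (n : ℕ) : InnerProductSpace.Core ℝ (SymMat n) where
  inner A B := ((toMatrix A).transpose * toMatrix B).trace
  conj_inner_symm A B := by
    rw [← Matrix.trace_transpose]
    simp
  re_inner_nonneg A := by
    have h : ∀ M : Matrix (Fin n) (Fin n) ℝ, 0 ≤ (M.transpose * M).trace := fun M => by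
      simp only [Matrix.trace, Matrix.diag, Matrix.mul_apply, Matrix.transpose_apply]
      exact Finset.sum_nonneg fun i _ => Finset.sum_nonneg fun j _ => mul_self_nonneg (M j i)
    exact h (toMatrix A)
  add_left A B C := by simp [Matrix.add_mul]
  smul_left A B c := by simp
  definite A hA := toMatrix_injective (by
    rw [map_zero]
    exact Matrix.trace_conjTranspose_mul_self_eq_zero_iff.1 hA)

instance (n : ℕ) : NormedAddCommGroup (SymMat n) :=
  @InnerProductSpace.Core.toNormedAddCommGroup ℝ (SymMat n) _ _ _ (innerCore n)

instance (n : ℕ) : InnerProductSpace ℝ (SymMat n) :=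
  InnerProductSpace.ofCore (innerCore n).toCore

theorem inner_eq_trace {n : ℕ} (A B : SymMat n) :
    ⟪A, B⟫_ℝ = ((toMatrix A).transpose * toMatrix B).trace := rfl

end SymMat

open SymMat

/-- The symmetric matrices of rank at most `r`. -/
def lowRank (n r : ℕ) : Set (SymMat n) :=
  {A | (toMatrix A).rank ≤ r}

/-- The nuclear norm of a symmetric matrix: the sum of its singular values, i.e. of the absolute
values of its eigenvalues (with multiplicity). -/
def nuclearNorm {n : ℕ} (A : SymMat n) : ℝ :=
  ∑ i, |(isHermitian_toMatrix A).eigenvalues i|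

theorem vecMulVec_self_isSymm {n : ℕ} (v : Fin n → ℝ) : (Matrix.vecMulVec v v).IsSymm := by
  ext i j
  simp [Matrix.vecMulVec_apply, mul_comm]

/-- A model set that is closed under scalar multiplication, spans the space and contains a nonzero
point induces an atomic norm which is finite everywhere. -/
theorem modelNorm_ne_top {H : Type*} [NormedAddCommGroup H] [NormedSpace ℝ H] {S : Set H}
    (hS : ∀ (c : ℝ), ∀ x ∈ S, c • x ∈ S) (hspan : Submodule.span ℝ S = ⊤)
    {w : H} (hw : w ∈ S) (hw0 : w ≠ 0) (x : H) : modelNorm S x ≠ ⊤ := by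
  set K : Set H := closure (convexHull ℝ (S ∩ Metric.sphere 0 1)) with hK
  have hKc : Convex ℝ K := (convex_convexHull ℝ _).closure
  suffices h : ∃ t : ℝ≥0, x ∈ (t : ℝ) • K by
    obtain ⟨t, ht⟩ := h
    exact ne_top_of_le_ne_top ENNReal.coe_ne_top (iInf₂_le t ht)
  have hunit : ∀ y ∈ S, y ≠ 0 → ‖y‖⁻¹ • y ∈ K := fun y hy hy0 =>
    subset_closure (subset_convexHull ℝ _ ⟨hS _ _ hy, by simp [norm_smul, hy0]⟩)
  have hx : x ∈ Submodule.span ℝ S := hspan ▸ Submodule.mem_top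
  induction hx using Submodule.closure_induction with
  | zero => exact ⟨0, ‖w‖⁻¹ • w, hunit w hw hw0, by simp⟩
  | add y z _ _ hy hz =>
    obtain ⟨s, hs⟩ := hy
    obtain ⟨t, ht⟩ := hz
    refine ⟨s + t, ?_⟩
    have e := hKc.add_smul s.2 t.2
    change y + z ∈ ((s : ℝ) + (t : ℝ)) • K
    exact e ▸ Set.add_mem_add hs ht
  | smul_mem c y hy =>
    by_cases h0 : c • y = 0
    · exact ⟨0, ‖w‖⁻¹ • w, hunit w hw hw0, by simp [h0]⟩
    · have hn : ‖c • y‖ ≠ 0 := norm_ne_zero_iff.2 h0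
      refine ⟨‖c • y‖₊, ‖c • y‖⁻¹ • (c • y), hunit _ (hS c y hy) h0, ?_⟩
      change ‖c • y‖ • ‖c • y‖⁻¹ • (c • y) = c • y
      rw [smul_inv_smul₀ hn]

/-- The atomic norm induced by the matrices of rank at most `r ≥ 1` is finite everywhere. -/
theorem modelNorm_lowRank_ne_top {n r : ℕ} (hn : 1 ≤ n) (hr : 1 ≤ r) (x : SymMat n) :
    modelNorm (lowRank n r) x ≠ ⊤ := by
  have hq : ∀ v : Fin n → ℝ,
      ofMatrix _ (vecMulVec_self_isSymm v) ∈ lowRank n r :=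
    fun v => (Matrix.rank_vecMulVec_le v v).trans hr
  refine modelNorm_ne_top (S := lowRank n r) (fun c y hy => ?_) ?_ (hq (fun _ => 1)) ?_ x
  · have e : toMatrix (c • y) =
        (c • (1 : Matrix (Fin n) (Fin n) ℝ)) * toMatrix y := by
      simp
    change Matrix.rank _ ≤ r
    rw [e]
    exact (Matrix.rank_mul_le_right _ _).trans hy
  · rw [eq_top_iff]
    rintro A -
    have hA : A = ∑ i, ∑ j, ((toMatrix A) i j / 2) •
        (ofMatrix _ (vecMulVec_self_isSymm (Pi.single i 1 + Pi.single j 1)) -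
          ofMatrix _ (vecMulVec_self_isSymm (Pi.single i 1)) -
          ofMatrix _ (vecMulVec_self_isSymm (Pi.single j 1))) := by
      apply toMatrix_injective
      ext k l
      have hs : (toMatrix A) l k = (toMatrix A) k l :=
        congrFun (congrFun (isSymm_toMatrix A) k) l
      have e : ∀ i j, (toMatrix A) i j / 2 *
          (((Pi.single i 1 + Pi.single j 1 : Fin n → ℝ) k *
            (Pi.single i 1 + Pi.single j 1 : Fin n → ℝ) l) -
            (Pi.single i 1 : Fin n → ℝ) k * (Pi.single i 1 : Fin n → ℝ) l -
            (Pi.single j 1 : Fin n → ℝ) k * (Pi.single j 1 : Fin n → ℝ) l) =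
          (if k = i then if l = j then (toMatrix A) i j / 2 else 0 else 0) +
          (if l = i then if k = j then (toMatrix A) i j / 2 else 0 else 0) := by
        intro i j
        simp only [Pi.add_apply, Pi.single_apply]
        split_ifs <;> ring
      simp only [map_sum, map_smul, map_sub, toMatrix_ofMatrix, Matrix.sum_apply,
        Matrix.smul_apply, Matrix.sub_apply, Matrix.vecMulVec_apply, smul_eq_mul, e,
        Finset.sum_add_distrib]
      simp [hs]
    rw [hA]
    exact Submodule.sum_mem _ fun i _ => Submodule.sum_mem _ fun j _ => Submodule.smul_mem _ _
      (Submodule.sub_mem _ (Submodule.sub_mem _ (Submodule.subset_span (hq _))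
        (Submodule.subset_span (hq _))) (Submodule.subset_span (hq _)))
  · intro h
    have := congrFun (congrFun (congrArg toMatrix h) ⟨0, hn⟩) ⟨0, hn⟩
    simp [toMatrix_ofMatrix, Matrix.vecMulVec_apply] at this

end

/-!
No function `R` does better than `1 / √2`: take two coordinate projections of rank `r` with disjoint
supports, which exist since `2 r ≤ n`. Up to sign their difference `z` is a descent direction at the
one where `R` is larger. The expression under the square root is at
least `‖z‖² = 2 r`, because the atomic norm dominates the Frobenius norm, whereas
`|⟪x, z⟫| ≤ √r ‖x‖` for `x` of rank at most `r` (`SymMat.suffRIP_lowRank_le`).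

For the nuclear norm, let `z ≠ 0` be a descent direction. Mirsky's inequality
`∑ |λᵢ(A) - λᵢ(B)| ≤ ‖A - B‖_*` (`SymMat.sum_abs_eig_sub_le`), a consequence of the monotonicity of
eigenvalues, shows that the `r` eigenvalues of `z` of largest modulus carry at least half of its
nuclear norm (`SymMat.exists_dominant_eigenvalues`, `sum_compl_le_sum_of_threshold`). Let `-x` be
the corresponding part of `z`, and `α` the mean modulus of these eigenvalues. The eigenvalues of
`x + z` are bounded by `α` in modulus and by `r α` in the `ℓ¹` norm, which places `x + z` in `α √r`
times the closed convex hull of the unit matrices of rank at most `r`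
(`SymMat.toReal_modelNorm_sum_le`, by separation). As `α √r ≤ ‖x‖`, this `x` makes the quotient at
least `‖x‖² / (‖x‖ √(2 ‖x‖²)) = 1 / √2`.

Convexity of the nuclear norm comes from its description as the least value of
`trace P + trace N` over the decompositions `A = P - N` into positive semidefinite matrices.
-/

/-! ### Rank-one projections and the spectral decomposition -/

namespace SymMat

variable {n : ℕ}

/-- The symmetric matrix `v vᵀ`. Every quadratic form `vᵀ A v` is the Frobenius inner product of
`A` with it, so that quadratic forms can be handled as inner products. -/
noncomputable def dyad (v : EuclideanSpace ℝ (Fin n)) : SymMat n :=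
  ofMatrix _ (vecMulVec_self_isSymm v.ofLp)

theorem inner_dyad_dyad (u v : EuclideanSpace ℝ (Fin n)) : ⟪dyad u, dyad v⟫_ℝ = ⟪u, v⟫_ℝ ^ 2 := by
  rw [inner_eq_trace, dyad, dyad, toMatrix_ofMatrix, toMatrix_ofMatrix, Matrix.transpose_vecMulVec,
    Matrix.vecMulVec_mul_vecMulVec, Matrix.trace_vecMulVec, dotProduct_smul, smul_eq_mul,
    EuclideanSpace.inner_eq_star_dotProduct, star_trivial, dotProduct_comm v.ofLp, sq]

theorem norm_dyad_of_norm_eq_one {v : EuclideanSpace ℝ (Fin n)} (hv : ‖v‖ = 1) : ‖dyad v‖ = 1 := by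
  have h := inner_dyad_dyad v v
  rw [real_inner_self_eq_norm_sq, real_inner_self_eq_norm_sq, hv] at h
  have := norm_nonneg (dyad v)
  nlinarith

theorem orthonormal_dyad (b : OrthonormalBasis (Fin n) ℝ (EuclideanSpace ℝ (Fin n))) :
    Orthonormal ℝ (fun i => dyad (b i)) := by
  rw [orthonormal_iff_ite]
  intro i j
  rw [inner_dyad_dyad, orthonormal_iff_ite.1 b.orthonormal]
  split_ifs <;> simp

/-- The eigenvalues of a symmetric matrix, ordered in the same way for all matrices of one size. -/
noncomputable def eig (A : SymMat n) : Fin n → ℝ := (isHermitian_toMatrix A).eigenvalues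

/-- An orthonormal basis of eigenvectors of a symmetric matrix. -/
noncomputable def eigBasis (A : SymMat n) :
    OrthonormalBasis (Fin n) ℝ (EuclideanSpace ℝ (Fin n)) :=
  (isHermitian_toMatrix A).eigenvectorBasis

theorem eq_sum_eig_smul_dyad (A : SymMat n) : A = ∑ i, eig A i • dyad (eigBasis A i) := by
  apply toMatrix_injective
  conv_lhs => rw [(isHermitian_toMatrix A).spectral_theorem, Unitary.conjStarAlgAut_apply]
  ext k l
  rw [Matrix.mul_apply]
  simp only [Matrix.mul_diagonal, map_sum, map_smul, Matrix.sum_apply,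
    Matrix.smul_apply, dyad, toMatrix_ofMatrix, Matrix.vecMulVec_apply, smul_eq_mul,
    Matrix.IsHermitian.eigenvectorUnitary_apply, Function.comp_apply, Matrix.star_apply,
    star_trivial, eig, eigBasis, RCLike.ofReal_real_eq_id, id_eq]
  exact Finset.sum_congr rfl fun i _ => by ring

/-- The quadratic form of `A` in the coordinates of an eigenbasis. -/
theorem inner_dyad_eq_sum_eig (A : SymMat n) (v : EuclideanSpace ℝ (Fin n)) :
    ⟪A, dyad v⟫_ℝ = ∑ i, eig A i * ⟪eigBasis A i, v⟫_ℝ ^ 2 := by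
  conv_lhs => rw [eq_sum_eig_smul_dyad A]
  simp [sum_inner, inner_smul_left, inner_dyad_dyad]

theorem inner_dyad_eigBasis (A : SymMat n) (i : Fin n) : ⟪A, dyad (eigBasis A i)⟫_ℝ = eig A i := by
  rw [inner_dyad_eq_sum_eig]
  simp [orthonormal_iff_ite.1 (eigBasis A).orthonormal]

theorem trace_eq_sum_eig (A : SymMat n) : (toMatrix A).trace = ∑ i, eig A i :=
  (isHermitian_toMatrix A).trace_eq_sum_eigenvalues

theorem sum_inner_dyad (A : SymMat n) (b : OrthonormalBasis (Fin n) ℝ (EuclideanSpace ℝ (Fin n))) :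
    ∑ i, ⟪A, dyad (b i)⟫_ℝ = (toMatrix A).trace := by
  simp_rw [inner_dyad_eq_sum_eig, trace_eq_sum_eig]
  rw [Finset.sum_comm]
  refine Finset.sum_congr rfl fun i _ => ?_
  rw [← Finset.mul_sum, b.sum_sq_inner_left, (eigBasis A).norm_eq_one]
  simp

theorem norm_sum_smul_dyad_sq (b : OrthonormalBasis (Fin n) ℝ (EuclideanSpace ℝ (Fin n)))
    (c : Fin n → ℝ) (T : Finset (Fin n)) : ‖∑ i ∈ T, c i • dyad (b i)‖ ^ 2 = ∑ i ∈ T, c i ^ 2 := by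
  rw [← real_inner_self_eq_norm_sq, (orthonormal_dyad b).inner_sum]
  simp [sq]

theorem sum_smul_dyad_mem_lowRank (b : Fin n → EuclideanSpace ℝ (Fin n))
    (c : Fin n → ℝ) {T : Finset (Fin n)} {r : ℕ} (hT : T.card ≤ r) :
    ∑ i ∈ T, c i • dyad (b i) ∈ lowRank n r := by
  have h : toMatrix (∑ i ∈ T, c i • dyad (b i)) =
      (Matrix.of fun k (i : T) => c i * b i k) * Matrix.of fun (i : T) l => b i l := by
    ext k l
    rw [Matrix.mul_apply]
    simp only [map_sum, map_smul, Matrix.sum_apply, Matrix.smul_apply, dyad, toMatrix_ofMatrix,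
      Matrix.vecMulVec_apply, smul_eq_mul, Matrix.of_apply]
    rw [← Finset.sum_coe_sort T]
    exact Finset.sum_congr rfl fun i _ => by ring
  change Matrix.rank _ ≤ r
  rw [h]
  refine ((Matrix.rank_mul_le_right _ _).trans (Matrix.rank_le_card_height _)).trans ?_
  simpa using hT

theorem card_eig_ne_zero_le {A : SymMat n} {r : ℕ} (hA : A ∈ lowRank n r) :
    (Finset.univ.filter fun i => eig A i ≠ 0).card ≤ r := by
  have h : (toMatrix A).rank ≤ r := hA
  rw [(isHermitian_toMatrix A).rank_eq_card_non_zero_eigs, Fintype.card_subtype] at h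
  exact h

/-! ### Monotonicity of eigenvalues -/

/-- **Weyl's monotonicity principle.** -/
theorem eig_mono {A B : SymMat n} (h : ∀ v, ⟪A, dyad v⟫_ℝ ≤ ⟪B, dyad v⟫_ℝ) (i : Fin n) :
    eig A i ≤ eig B i := by
  obtain ⟨e, he⟩ : ∃ e : Fin n ≃ Fin (Fintype.card (Fin n)), ∀ (C : SymMat n) (j k : Fin n),
      e j ≤ e k → eig C k ≤ eig C j :=
    ⟨(Fintype.equivOfCardEq (Fintype.card_fin _)).symm, fun C j k hjk =>
      (isHermitian_toMatrix C).eigenvalues₀_antitone hjk⟩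
  -- Fewer than `n` linear conditions put `v` into the span of the eigenvectors of `A` up to `i`
  -- and into the span of those of `B` from `i` on.
  let L : EuclideanSpace ℝ (Fin n) →ₗ[ℝ] ({j : Fin n // j ≠ i} → ℝ) :=
    LinearMap.pi fun j => if e i < e j then (innerSL ℝ (eigBasis A j)).toLinearMap
      else (innerSL ℝ (eigBasis B j)).toLinearMap
  have hL : LinearMap.ker L ≠ ⊥ := by
    apply LinearMap.ker_ne_bot_of_finrank_lt
    have := i.pos
    simp
    omega
  obtain ⟨v, hv, hv0⟩ := Submodule.exists_mem_ne_zero_of_ne_bot hL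
  have hLv : ∀ j (hj : j ≠ i), L v ⟨j, hj⟩ = 0 := fun j hj => by
    rw [LinearMap.mem_ker.1 hv]; rfl
  have hA : eig A i * ‖v‖ ^ 2 ≤ ⟪A, dyad v⟫_ℝ := by
    rw [inner_dyad_eq_sum_eig, ← (eigBasis A).sum_sq_inner_right v, Finset.mul_sum]
    refine Finset.sum_le_sum fun j _ => ?_
    rcases lt_or_ge (e i) (e j) with hij | hij
    · have := hLv j (by rintro rfl; exact hij.false)
      simp only [L, LinearMap.pi_apply, if_pos hij] at this
      have h0 : ⟪eigBasis A j, v⟫_ℝ = 0 := this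
      simp [h0]
    · exact mul_le_mul_of_nonneg_right (he A _ _ hij) (sq_nonneg _)
  have hB : ⟪B, dyad v⟫_ℝ ≤ eig B i * ‖v‖ ^ 2 := by
    rw [inner_dyad_eq_sum_eig, ← (eigBasis B).sum_sq_inner_right v, Finset.mul_sum]
    refine Finset.sum_le_sum fun j _ => ?_
    rcases le_or_gt (e i) (e j) with hij | hij
    · exact mul_le_mul_of_nonneg_right (he B _ _ hij) (sq_nonneg _)
    · have := hLv j (by rintro rfl; exact hij.false)
      simp only [L, LinearMap.pi_apply, if_neg hij.not_gt] at this
      have h0 : ⟪eigBasis B j, v⟫_ℝ = 0 := this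
      simp [h0]
  exact le_of_mul_le_mul_right (hA.trans ((h v).trans hB)) (by positivity)

/-! ### The nuclear norm -/

/-- The positive and negative parts of a symmetric matrix. -/
theorem exists_posPart_negPart (A : SymMat n) : ∃ P N : SymMat n, A = P - N ∧
    (∀ v, 0 ≤ ⟪P, dyad v⟫_ℝ) ∧ (∀ v, 0 ≤ ⟪N, dyad v⟫_ℝ) ∧
    (toMatrix P).trace + (toMatrix N).trace = nuclearNorm A := by
  have tr : ∀ c : Fin n → ℝ, (toMatrix (∑ i, c i • dyad (eigBasis A i))).trace = ∑ i, c i := by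
    intro c
    rw [← sum_inner_dyad _ (eigBasis A)]
    simp [sum_inner, inner_smul_left, inner_dyad_dyad,
      orthonormal_iff_ite.1 (eigBasis A).orthonormal]
  have psd : ∀ c : Fin n → ℝ, (∀ i, 0 ≤ c i) → ∀ v,
      0 ≤ ⟪∑ i, c i • dyad (eigBasis A i), dyad v⟫_ℝ := by
    intro c hc v
    simp only [sum_inner, inner_smul_left, inner_dyad_dyad]
    exact Finset.sum_nonneg fun i _ => mul_nonneg (hc i) (sq_nonneg _)
  refine ⟨∑ i, (eig A i)⁺ • dyad (eigBasis A i), ∑ i, (eig A i)⁻ • dyad (eigBasis A i), ?_,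
    psd _ fun i => posPart_nonneg _, psd _ fun i => negPart_nonneg _, ?_⟩
  · rw [← Finset.sum_sub_distrib]
    simp_rw [← sub_smul, posPart_sub_negPart]
    exact eq_sum_eig_smul_dyad A
  · rw [tr, tr, ← Finset.sum_add_distrib]
    exact Finset.sum_congr rfl fun i _ => posPart_add_negPart _

theorem nuclearNorm_sub_le_trace_add_trace {P N : SymMat n} (hP : ∀ v, 0 ≤ ⟪P, dyad v⟫_ℝ)
    (hN : ∀ v, 0 ≤ ⟪N, dyad v⟫_ℝ) :
    nuclearNorm (P - N) ≤ (toMatrix P).trace + (toMatrix N).trace := by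
  rw [← sum_inner_dyad P (eigBasis (P - N)), ← sum_inner_dyad N (eigBasis (P - N)),
    ← Finset.sum_add_distrib]
  refine Finset.sum_le_sum fun i _ => ?_
  change |eig (P - N) i| ≤ _
  rw [← inner_dyad_eigBasis, inner_sub_left]
  have h1 := hP (eigBasis (P - N) i)
  have h2 := hN (eigBasis (P - N) i)
  rw [abs_le]
  constructor <;> linarith

theorem norm_le_nuclearNorm (A : SymMat n) : ‖A‖ ≤ nuclearNorm A := by
  conv_lhs => rw [eq_sum_eig_smul_dyad A]
  refine (norm_sum_le _ _).trans (Finset.sum_le_sum fun i _ => ?_)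
  rw [norm_smul, norm_dyad_of_norm_eq_one ((eigBasis A).norm_eq_one i), mul_one]
  rfl

theorem nuclearNorm_mem_regularizers : (nuclearNorm : SymMat n → ℝ) ∈ regularizers (SymMat n) := by
  have hc : ConvexOn ℝ univ (nuclearNorm : SymMat n → ℝ) := by
    refine ⟨convex_univ, fun A _ B _ a b ha hb _ => ?_⟩
    obtain ⟨P, N, hA, hP, hN, hAt⟩ := exists_posPart_negPart A
    obtain ⟨P', N', hB, hP', hN', hBt⟩ := exists_posPart_negPart B
    have e : a • A + b • B = (a • P + b • P') - (a • N + b • N') := by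
      rw [hA, hB]; module
    have key : ∀ {C D : SymMat n}, (∀ v, 0 ≤ ⟪C, dyad v⟫_ℝ) → (∀ v, 0 ≤ ⟪D, dyad v⟫_ℝ) →
        ∀ v, 0 ≤ ⟪a • C + b • D, dyad v⟫_ℝ := fun hC hD v => by
      rw [inner_add_left, real_inner_smul_left, real_inner_smul_left]
      exact add_nonneg (mul_nonneg ha (hC v)) (mul_nonneg hb (hD v))
    rw [e]
    refine (nuclearNorm_sub_le_trace_add_trace (key hP hP') (key hN hN')).trans_eq ?_
    rw [← hAt, ← hBt]
    simp only [map_add, map_smul, Matrix.trace_add, Matrix.trace_smul, smul_eq_mul]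
    ring
  exact ⟨hc, hc.locallyLipschitz.continuous,
    tendsto_atTop_mono norm_le_nuclearNorm tendsto_norm_cobounded_atTop⟩

/-- **Mirsky's inequality** for the trace norm: adding the positive part of `A - B` to `B`, or the
negative part to `A`, gives a common upper bound `D` of `A` and `B`; by monotonicity the
eigenvalues of both lie below those of `D`, and the total gaps are the two traces. -/
theorem sum_abs_eig_sub_le (A B : SymMat n) :
    ∑ i, |eig A i - eig B i| ≤ nuclearNorm (A - B) := by
  obtain ⟨P, N, hAB, hP, hN, ht⟩ := exists_posPart_negPart (A - B)
  have hD : A + N = B + P := by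
    rw [sub_eq_sub_iff_add_eq_add] at hAB
    rw [hAB, add_comm]
  have hA : ∀ i, eig A i ≤ eig (A + N) i := eig_mono fun v => by
    rw [inner_add_left]; linarith [hN v]
  have hB : ∀ i, eig B i ≤ eig (A + N) i := eig_mono fun v => by
    rw [hD, inner_add_left]; linarith [hP v]
  have tA : ∑ i, eig (A + N) i = ∑ i, eig A i + (toMatrix N).trace := by
    rw [← trace_eq_sum_eig, ← trace_eq_sum_eig, map_add, Matrix.trace_add]
  have tB : ∑ i, eig (A + N) i = ∑ i, eig B i + (toMatrix P).trace := by
    rw [hD, ← trace_eq_sum_eig, ← trace_eq_sum_eig, map_add, Matrix.trace_add]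
  calc ∑ i, |eig A i - eig B i|
      ≤ ∑ i, ((eig (A + N) i - eig A i) + (eig (A + N) i - eig B i)) :=
        Finset.sum_le_sum fun i _ => by
          rw [abs_le]; constructor <;> linarith [hA i, hB i]
    _ = nuclearNorm (A - B) := by
        rw [Finset.sum_add_distrib, Finset.sum_sub_distrib, Finset.sum_sub_distrib, ← ht]
        linarith

/-- The null space property: if the nuclear norm does not increase from `x`, of rank at most `r`,
to `x + z`, then at most `r` eigenvalues of `z` carry at least half of its nuclear norm; this
passes to all multiples of `z`. Mirsky's inequality for `x` and `-z` gives it, with the support of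
the spectrum of `x` as index set. -/
theorem exists_dominant_eigenvalues {r : ℕ} {x z : SymMat n} (hx : x ∈ lowRank n r)
    (h : nuclearNorm (x + z) ≤ nuclearNorm x) (γ : ℝ) :
    ∃ (b : OrthonormalBasis (Fin n) ℝ (EuclideanSpace ℝ (Fin n))) (c : Fin n → ℝ)
      (I : Finset (Fin n)), γ • z = ∑ i, c i • dyad (b i) ∧ I.card ≤ r ∧
        ∑ i ∈ Iᶜ, |c i| ≤ ∑ i ∈ I, |c i| := by
  refine ⟨eigBasis (-z), fun i => -γ * eig (-z) i, Finset.univ.filter fun i => eig x i ≠ 0, ?_,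
    card_eig_ne_zero_le hx, ?_⟩
  · simp_rw [mul_smul, ← Finset.smul_sum, ← eq_sum_eig_smul_dyad]
    simp
  · simp_rw [abs_mul, ← Finset.mul_sum]
    refine mul_le_mul_of_nonneg_left ?_ (abs_nonneg _)
    set I := Finset.univ.filter fun i => eig x i ≠ 0
    have hm := (sum_abs_eig_sub_le x (-z)).trans ((sub_neg_eq_add x z).symm ▸ h)
    change _ ≤ ∑ i, |eig x i| at hm
    have h0 : ∀ i ∈ Iᶜ, eig x i = 0 := by simp [I]
    have e1 : ∑ i ∈ Iᶜ, |eig x i - eig (-z) i| = ∑ i ∈ Iᶜ, |eig (-z) i| :=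
      Finset.sum_congr rfl fun i hi => by rw [h0 i hi, zero_sub, abs_neg]
    have e2 : ∑ i ∈ Iᶜ, |eig x i| = 0 := Finset.sum_eq_zero fun i hi => by rw [h0 i hi, abs_zero]
    have e3 : ∑ i ∈ I, |eig x i| - ∑ i ∈ I, |eig (-z) i| ≤ ∑ i ∈ I, |eig x i - eig (-z) i| := by
      rw [← Finset.sum_sub_distrib]
      exact Finset.sum_le_sum fun i _ => abs_sub_abs_le_abs_sub _ _
    rw [← Finset.sum_add_sum_compl I, ← Finset.sum_add_sum_compl I, e1, e2] at hm
    linarith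

end SymMat

/-! ### The largest entries of a vector -/

/-- A set of `r` indices at which `w` is largest, with a threshold `m` that separates it from the
other indices. -/
theorem exists_card_eq_threshold {ι : Type*} [Fintype ι] [DecidableEq ι] {w : ι → ℝ}
    (hw : ∀ i, 0 ≤ w i) {r : ℕ} (hr : r ≤ Fintype.card ι) :
    ∃ (T : Finset ι) (m : ℝ), T.card = r ∧ 0 ≤ m ∧ (∀ i ∈ T, m ≤ w i) ∧ ∀ i ∉ T, w i ≤ m := by
  induction r with
  | zero =>
    exact ⟨∅, ∑ i, w i, rfl, Finset.sum_nonneg fun i _ => hw i, by simp,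
      fun i _ => Finset.single_le_sum (fun j _ => hw j) (Finset.mem_univ i)⟩
  | succ k ih =>
    obtain ⟨T, m, hT, -, hmT, hmTc⟩ := ih (by omega)
    have hne : Tᶜ.Nonempty := by
      rw [← Finset.card_pos, Finset.card_compl]
      omega
    obtain ⟨j, hj, hjmax⟩ := Tᶜ.exists_max_image w hne
    rw [Finset.mem_compl] at hj
    refine ⟨insert j T, w j, by rw [Finset.card_insert_of_notMem hj, hT], hw j, ?_, ?_⟩
    · intro i hi
      rcases Finset.mem_insert.1 hi with rfl | hi
      · exact le_rfl
      · exact (hmTc j hj).trans (hmT i hi)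
    · intro i hi
      exact hjmax i (Finset.mem_compl.2 fun h => hi (Finset.mem_insert_of_mem h))

/-- A linear form with coefficients `w` on the polytope `|c i| ≤ α`, `∑ |c i| ≤ r α` is bounded by
`α` times the sum of the `r` largest coefficients. -/
theorem sum_mul_le_mul_sum_largest {ι : Type*} [Fintype ι] [DecidableEq ι] {c w : ι → ℝ} {α m : ℝ}
    {T : Finset ι} (hc : ∀ i, |c i| ≤ α) (hsum : ∑ i, |c i| ≤ T.card * α) (hm : 0 ≤ m)
    (hmT : ∀ i ∈ T, m ≤ |w i|) (hmTc : ∀ i ∉ T, |w i| ≤ m) :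
    ∑ i, c i * w i ≤ α * ∑ i ∈ T, |w i| := by
  have h1 : ∑ i ∈ Tᶜ, |c i| * |w i| ≤ m * ∑ i ∈ Tᶜ, |c i| := by
    rw [Finset.mul_sum]
    refine Finset.sum_le_sum fun i hi => ?_
    rw [mul_comm m]
    exact mul_le_mul_of_nonneg_left (hmTc i (Finset.mem_compl.1 hi)) (abs_nonneg _)
  have h2 : ∑ i ∈ T, m * (α - |c i|) ≤ ∑ i ∈ T, |w i| * (α - |c i|) :=
    Finset.sum_le_sum fun i hi => mul_le_mul_of_nonneg_right (hmT i hi) (sub_nonneg.2 (hc i))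
  have h3 : ∑ i ∈ T, m * (α - |c i|) = m * (T.card * α - ∑ i ∈ T, |c i|) := by
    rw [← Finset.mul_sum, Finset.sum_sub_distrib, Finset.sum_const, nsmul_eq_mul]
  have h4 : ∑ i ∈ T, |w i| * (α - |c i|) = α * ∑ i ∈ T, |w i| - ∑ i ∈ T, |c i| * |w i| := by
    rw [Finset.mul_sum, ← Finset.sum_sub_distrib]
    exact Finset.sum_congr rfl fun i _ => by ring
  rw [← Finset.sum_add_sum_compl T] at hsum
  have h5 := mul_le_mul_of_nonneg_left hsum hm
  calc ∑ i, c i * w i ≤ ∑ i, |c i| * |w i| :=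
        Finset.sum_le_sum fun i _ => (le_abs_self _).trans_eq (abs_mul _ _)
    _ = ∑ i ∈ T, |c i| * |w i| + ∑ i ∈ Tᶜ, |c i| * |w i| := (Finset.sum_add_sum_compl T _).symm
    _ ≤ α * ∑ i ∈ T, |w i| := by linarith

/-- The `r` largest entries dominate the others as soon as some `r` entries do. -/
theorem sum_compl_le_sum_of_threshold {ι : Type*} [Fintype ι] [DecidableEq ι] {w : ι → ℝ} {m : ℝ}
    {I T : Finset ι} (hIT : I.card ≤ T.card) (hm : 0 ≤ m) (hmT : ∀ i ∈ T, m ≤ w i)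
    (hmTc : ∀ i ∉ T, w i ≤ m) (hI : ∑ i ∈ Iᶜ, w i ≤ ∑ i ∈ I, w i) :
    ∑ i ∈ Tᶜ, w i ≤ ∑ i ∈ T, w i := by
  have key : ∑ i ∈ I, w i ≤ ∑ i ∈ T, w i := by
    rw [← Finset.sum_inter_add_sum_sdiff I T, ← Finset.sum_inter_add_sum_sdiff T I,
      Finset.inter_comm T I]
    have h1 : ∑ i ∈ I \ T, w i ≤ (I \ T).card * m := by
      rw [← nsmul_eq_mul]
      exact Finset.sum_le_card_nsmul _ _ _ fun i hi => hmTc i (Finset.mem_sdiff.1 hi).2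
    have h2 : (T \ I).card * m ≤ ∑ i ∈ T \ I, w i := by
      rw [← nsmul_eq_mul]
      exact Finset.card_nsmul_le_sum _ _ _ fun i hi => hmT i (Finset.mem_sdiff.1 hi).1
    have h3 : ((I \ T).card : ℝ) * m ≤ (T \ I).card * m := by
      refine mul_le_mul_of_nonneg_right ?_ hm
      exact_mod_cast (Finset.card_sdiff_le_card_sdiff_iff).2 hIT
    linarith
  have e1 := Finset.sum_add_sum_compl I w
  have e2 := Finset.sum_add_sum_compl T w
  linarith

/-! ### Bounds on the atomic norm -/

/-- An atomic norm with atoms in the unit sphere dominates the norm of the space. -/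
theorem ofReal_norm_le_modelNorm {H : Type*} [NormedAddCommGroup H] [NormedSpace ℝ H] (S : Set H)
    (x : H) : ENNReal.ofReal ‖x‖ ≤ modelNorm S x := by
  refine le_iInf₂ fun t ht => ?_
  obtain ⟨y, hy, rfl⟩ := ht
  have hy1 : y ∈ Metric.closedBall (0 : H) 1 :=
    closure_minimal (convexHull_min (inter_subset_right.trans Metric.sphere_subset_closedBall)
      (convex_closedBall _ _)) Metric.isClosed_closedBall hy
  rw [mem_closedBall_zero_iff] at hy1
  refine ENNReal.ofReal_le_of_le_toReal ?_
  change ‖(t : ℝ) • y‖ ≤ t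
  rw [norm_smul, Real.norm_of_nonneg t.coe_nonneg]
  exact mul_le_of_le_one_right t.2 hy1

theorem norm_le_toReal_modelNorm {H : Type*} [NormedAddCommGroup H] [NormedSpace ℝ H] {S : Set H}
    {x : H} (h : modelNorm S x ≠ ⊤) : ‖x‖ ≤ (modelNorm S x).toReal :=
  (ENNReal.ofReal_le_iff_le_toReal h).1 (ofReal_norm_le_modelNorm S x)

namespace SymMat

variable {n : ℕ}

/-- A symmetric matrix whose eigenvalues are bounded by `α` and whose nuclear norm is at most
`r α` lies in `α √r` times the unit ball of the atomic norm: otherwise a separating functional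
would exceed, on the polytope of these eigenvalue vectors, its value at a rank-`r` extreme point. -/
theorem toReal_modelNorm_sum_le (b : OrthonormalBasis (Fin n) ℝ (EuclideanSpace ℝ (Fin n)))
    {c : Fin n → ℝ} {r : ℕ} {α : ℝ} (hr : 1 ≤ r) (hrn : r ≤ n) (hα : 0 < α)
    (hc : ∀ i, |c i| ≤ α) (hsum : ∑ i, |c i| ≤ r * α) :
    (modelNorm (lowRank n r) (∑ i, c i • dyad (b i))).toReal ≤ α * √r := by
  have ht : 0 < α * √r := by positivity
  set t := α * √r
  set x := ∑ i, c i • dyad (b i)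
  set K := closure (convexHull ℝ (lowRank n r ∩ Metric.sphere (0 : SymMat n) 1))
  have hK : ∀ (T : Finset (Fin n)) (w : Fin n → ℝ), T.card ≤ r →
      ‖∑ i ∈ T, w i • dyad (b i)‖ = 1 → ∑ i ∈ T, w i • dyad (b i) ∈ K := fun T w hT h1 =>
    subset_closure (subset_convexHull ℝ _ ⟨sum_smul_dyad_mem_lowRank b w hT, by simpa using h1⟩)
  suffices hx : t⁻¹ • x ∈ K by
    have h : modelNorm (lowRank n r) x ≤ ENNReal.ofNNReal ⟨t, ht.le⟩ :=
      iInf₂_le (⟨t, ht.le⟩ : ℝ≥0) ⟨_, hx, smul_inv_smul₀ ht.ne' x⟩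
    exact ENNReal.toReal_mono ENNReal.coe_ne_top h
  by_contra hx
  obtain ⟨f, u, hf, hu⟩ := geometric_hahn_banach_closed_point
    (convex_convexHull ℝ _).closure isClosed_closure hx
  have hu0 : 0 < u := by
    have i₀ : Fin n := ⟨0, by omega⟩
    have h1 := hf _ (hK {i₀} (fun _ => 1) (by simpa using hr) (by
      simp [norm_dyad_of_norm_eq_one (b.norm_eq_one i₀)]))
    have h2 := hf _ (hK {i₀} (fun _ => -1) (by simpa using hr) (by
      simp [norm_dyad_of_norm_eq_one (b.norm_eq_one i₀)]))
    simp only [Finset.sum_singleton, map_smul, smul_eq_mul] at h1 h2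
    linarith
  set w : Fin n → ℝ := fun i => f (dyad (b i))
  obtain ⟨T, m, hT, hm, hmT, hmTc⟩ := exists_card_eq_threshold (w := fun i => |w i|)
    (fun i => abs_nonneg _) (r := r) (by simpa using hrn)
  -- The functional is largest at the normalized truncation of `w` to `T`.
  have hW : √(∑ i ∈ T, w i ^ 2) ≤ u := by
    set W := ∑ i ∈ T, w i ^ 2
    have hW0 : 0 ≤ W := Finset.sum_nonneg fun i _ => sq_nonneg (w i)
    rcases hW0.eq_or_lt with h0 | h0
    · rw [← h0, Real.sqrt_zero]; exact hu0.le
    have hs : 0 < √W := Real.sqrt_pos.2 h0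
    have h1 := hf _ (hK T (fun i => (√W)⁻¹ * w i) hT.le (by
      have h := norm_sum_smul_dyad_sq b (fun i => (√W)⁻¹ * w i) T
      simp_rw [mul_pow] at h
      rw [← Finset.mul_sum, inv_pow, Real.sq_sqrt h0.le, inv_mul_cancel₀ h0.ne'] at h
      exact (pow_eq_one_iff_of_nonneg (norm_nonneg _) two_ne_zero).1 h))
    have h2 : f (∑ i ∈ T, ((√W)⁻¹ * w i) • dyad (b i)) = √W := by
      rw [map_sum]
      calc ∑ i ∈ T, f (((√W)⁻¹ * w i) • dyad (b i)) = (√W)⁻¹ * W := by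
            rw [Finset.mul_sum]
            refine Finset.sum_congr rfl fun i _ => ?_
            rw [map_smul, smul_eq_mul]
            change _ * w i * w i = _
            ring
        _ = √W := by
            rw [inv_mul_eq_div, Real.div_sqrt]
    rw [h2] at h1
    exact h1.le
  have h1 : f x ≤ α * ∑ i ∈ T, |w i| := by
    have e : f x = ∑ i, c i * w i := by simp [x, w]
    rw [e]
    exact sum_mul_le_mul_sum_largest hc (hT.symm ▸ hsum) hm hmT hmTc
  have h2 : ∑ i ∈ T, |w i| ≤ √r * √(∑ i ∈ T, w i ^ 2) := by
    rw [← Real.sqrt_mul (Nat.cast_nonneg r)]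
    refine Real.le_sqrt_of_sq_le ?_
    have := sq_sum_le_card_mul_sum_sq (s := T) (f := fun i => |w i|)
    simpa [hT] using this
  have h3 : f x ≤ t * u :=
    calc f x ≤ α * (√r * u) := h1.trans (mul_le_mul_of_nonneg_left
          (h2.trans (mul_le_mul_of_nonneg_left hW (Real.sqrt_nonneg _))) hα.le)
      _ = t * u := (mul_assoc _ _ _).symm
  rw [map_smul, smul_eq_mul, inv_mul_eq_div, lt_div_iff₀ ht] at hu
  linarith

/-! ### The two bounds on the sufficient constant -/

/-- For `z ≠ 0` in the descent cone of the nuclear norm, the best approximation `x` of `-z` of rank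
at most `r` makes the quotient at least `1 / √2`, since then `‖x + z‖_S ≤ ‖x‖`. -/
theorem le_suffRIP_nuclearNorm {r : ℕ} (hr : 1 ≤ r) (hrn : r ≤ n) :
    ((1 / √2 : ℝ) : EReal) ≤ suffRIP (lowRank n r) (nuclearNorm : SymMat n → ℝ) := by
  refine le_iInf₂ fun z hz => ?_
  obtain ⟨hz, hz0⟩ := hz
  obtain ⟨x₀, hx₀, γ, z₀, hz₀, rfl⟩ := mem_iUnion₂.1 hz
  obtain ⟨b, c, I, hzc, hI, hIc⟩ := exists_dominant_eigenvalues hx₀ hz₀ γ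
  obtain ⟨T, m, hT, hm, hmT, hmTc⟩ := exists_card_eq_threshold (w := fun i => |c i|)
    (fun i => abs_nonneg _) (r := r) (by simpa using hrn)
  have hTc := sum_compl_le_sum_of_threshold (hI.trans hT.ge) hm hmT hmTc hIc
  set z := γ • z₀
  set s := ∑ i ∈ T, |c i|
  have hr0 : (0 : ℝ) < r := by exact_mod_cast hr
  have hs : 0 < s := by
    refine (Finset.sum_nonneg fun i _ => abs_nonneg _ : 0 ≤ s).lt_of_ne fun h => hz0 ?_
    have h1 := Finset.sum_add_sum_compl T fun i => |c i|
    have h2 : ∑ i, |c i| = 0 := le_antisymm (by change s + _ = _ at h1; linarith)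
      (Finset.sum_nonneg fun i _ => abs_nonneg _)
    rw [mem_singleton_iff, hzc]
    refine Finset.sum_eq_zero fun i hi => ?_
    rw [abs_eq_zero.1 ((Finset.sum_eq_zero_iff_of_nonneg fun i _ => abs_nonneg _).1 h2 i hi),
      zero_smul]
  set x := -∑ i ∈ T, c i • dyad (b i) with hx
  have hxz : x + z = ∑ i, (if i ∈ T then 0 else c i) • dyad (b i) := by
    rw [hzc, hx, ← Finset.sum_add_sum_compl T fun i => c i • dyad (b i), neg_add_cancel_left]
    simp only [ite_smul, zero_smul, ← Finset.mem_compl (s := T), Finset.sum_ite,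
      Finset.sum_const_zero, zero_add]
    refine Finset.sum_congr ?_ fun _ _ => rfl
    ext; simp
  have hxn : ‖x‖ ^ 2 = ∑ i ∈ T, c i ^ 2 := by rw [hx, norm_neg, norm_sum_smul_dyad_sq]
  have hsx : s ^ 2 ≤ r * ‖x‖ ^ 2 := by
    have := sq_sum_le_card_mul_sum_sq (s := T) (f := fun i => |c i|)
    simpa [hT, hxn] using this
  have hx0 : 0 < ‖x‖ := by
    refine (norm_nonneg x).lt_of_ne fun h => ?_
    rw [← h] at hsx
    nlinarith
  have hxin : -⟪x, z⟫_ℝ = ‖x‖ ^ 2 := by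
    have h : ⟪x, x + z⟫_ℝ = 0 := by
      rw [hxz, hx, inner_neg_left, neg_eq_zero, sum_inner]
      refine Finset.sum_eq_zero fun i hi => ?_
      rw [inner_sum]
      refine Finset.sum_eq_zero fun j _ => ?_
      rw [real_inner_smul_left, real_inner_smul_right,
        orthonormal_iff_ite.1 (orthonormal_dyad b)]
      by_cases hij : i = j
      · subst hij; simp [hi]
      · simp [hij]
    rw [inner_add_right, real_inner_self_eq_norm_sq] at h
    linarith
  have hmle : m ≤ s / r := by
    rw [le_div_iff₀ hr0, mul_comm, ← hT, ← nsmul_eq_mul]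
    exact Finset.card_nsmul_le_sum _ _ _ hmT
  have hM : (modelNorm (lowRank n r) (x + z)).toReal ≤ ‖x‖ := by
    rw [hxz]
    refine (toReal_modelNorm_sum_le b hr hrn (div_pos hs hr0) (fun i => ?_) ?_).trans ?_
    · by_cases hi : i ∈ T
      · simp only [hi, if_true, abs_zero]; positivity
      · simp only [hi, if_false]; exact (hmTc i hi).trans hmle
    · rw [mul_div_cancel₀ _ hr0.ne', ← Finset.sum_add_sum_compl T,
        Finset.sum_eq_zero fun i hi => by simp [hi], zero_add]
      refine le_trans (le_of_eq (Finset.sum_congr rfl fun i hi => ?_)) hTc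
      rw [if_neg (Finset.mem_compl.1 hi)]
    · refine abs_le_of_sq_le_sq' ?_ hx0.le |>.2
      rw [mul_pow, div_pow, Real.sq_sqrt hr0.le]
      have : s ^ 2 / (r : ℝ) ^ 2 * r = s ^ 2 / r := by field_simp
      rw [this, div_le_iff₀ hr0]
      linarith
  have hxS : x ∈ lowRank n r := by
    have := sum_smul_dyad_mem_lowRank b (fun i => -c i) hT.le
    simpa [hx] using this
  refine le_iSup₂_of_le x ⟨hxS, norm_pos_iff.1 hx0⟩ (EReal.coe_le_coe_iff.2 ?_)
  set M := (modelNorm (lowRank n r) (x + z)).toReal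
  have hM0 : 0 ≤ M := ENNReal.toReal_nonneg
  have e : M ^ 2 - ‖x‖ ^ 2 - 2 * ⟪x, z⟫_ℝ = M ^ 2 + ‖x‖ ^ 2 := by linarith
  rw [e, hxin, sq ‖x‖, mul_div_mul_left _ _ hx0.ne', ← sq]
  have hden : √(M ^ 2 + ‖x‖ ^ 2) ≤ √2 * ‖x‖ := by
    rw [← Real.sqrt_sq hx0.le, ← Real.sqrt_mul (by norm_num), Real.sqrt_sq hx0.le]
    exact Real.sqrt_le_sqrt (by nlinarith)
  rw [div_le_div_iff₀ (by positivity) (by positivity), one_mul, mul_comm]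
  exact hden

/-- The inner product of a matrix of rank at most `r` with a contraction. -/
theorem abs_inner_le_of_mem_lowRank {r : ℕ} {x z : SymMat n} (hx : x ∈ lowRank n r)
    (hz : ∀ v : EuclideanSpace ℝ (Fin n), ‖v‖ = 1 → |⟪dyad v, z⟫_ℝ| ≤ 1) :
    |⟪x, z⟫_ℝ| ≤ √r * ‖x‖ := by
  set J := Finset.univ.filter fun i => eig x i ≠ 0
  have hJ : x = ∑ i ∈ J, eig x i • dyad (eigBasis x i) := by
    conv_lhs => rw [eq_sum_eig_smul_dyad x]
    refine (Finset.sum_subset (Finset.subset_univ J) fun i _ hi => ?_).symm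
    have : eig x i = 0 := by simpa [J] using hi
    rw [this, zero_smul]
  have hxn : ‖x‖ ^ 2 = ∑ i ∈ J, eig x i ^ 2 := by
    conv_lhs => rw [hJ, norm_sum_smul_dyad_sq]
  have h1 : |⟪x, z⟫_ℝ| ≤ ∑ i ∈ J, |eig x i| := by
    conv_lhs => rw [hJ, sum_inner]
    refine (Finset.abs_sum_le_sum_abs _ _).trans (Finset.sum_le_sum fun i _ => ?_)
    rw [real_inner_smul_left, abs_mul]
    exact mul_le_of_le_one_right (abs_nonneg _) (hz _ ((eigBasis x).norm_eq_one i))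
  refine h1.trans ?_
  rw [← Real.sqrt_sq (norm_nonneg x), ← Real.sqrt_mul (Nat.cast_nonneg r)]
  refine Real.le_sqrt_of_sq_le ((sq_sum_le_card_mul_sum_sq (s := J)).trans ?_)
  rw [hxn]
  simp only [sq_abs]
  refine mul_le_mul_of_nonneg_right ?_ (Finset.sum_nonneg fun i _ => sq_nonneg _)
  exact_mod_cast card_eig_ne_zero_le hx

/-- For every function `R`, convex or not, the difference of the coordinate projections onto two
disjoint sets of `r` coordinates is a descent direction up to sign, at whichever of them has the
larger value of `R`. Its `2 r` nonzero eigenvalues all have modulus one, so that matrices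
of rank `r` capture at most half of its squared norm. -/
theorem suffRIP_lowRank_le {r : ℕ} (hr : 1 ≤ r) (hrn : 2 * r ≤ n) (R : SymMat n → ℝ) :
    suffRIP (lowRank n r) R ≤ ((1 / √2 : ℝ) : EReal) := by
  set b := EuclideanSpace.basisFun (Fin n) ℝ
  obtain ⟨T₁, -, hT₁⟩ := Finset.exists_subset_card_eq (s := (Finset.univ : Finset (Fin n)))
    (n := r) (by rw [Finset.card_fin]; omega)
  obtain ⟨T₂, hT, hT₂⟩ := Finset.exists_subset_card_eq (s := T₁ᶜ) (n := r)
    (by rw [Finset.card_compl, Fintype.card_fin]; omega)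
  have hdisj : Disjoint T₁ T₂ := Finset.disjoint_left.2 fun i hi hi' =>
    Finset.mem_compl.1 (hT hi') hi
  set x₁ := ∑ i ∈ T₁, (1 : ℝ) • dyad (b i)
  set x₂ := ∑ i ∈ T₂, (1 : ℝ) • dyad (b i)
  have hx₁ : x₁ ∈ lowRank n r := sum_smul_dyad_mem_lowRank b _ hT₁.le
  have hx₂ : x₂ ∈ lowRank n r := sum_smul_dyad_mem_lowRank b _ hT₂.le
  have hmem : x₁ - x₂ ∈ descentCone R (lowRank n r) := by
    rcases le_total (R x₁) (R x₂) with h | h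
    · exact mem_iUnion₂.2 ⟨x₂, hx₂, 1, x₁ - x₂, by simpa using h, (one_smul ℝ _).symm⟩
    · exact mem_iUnion₂.2 ⟨x₁, hx₁, -1, x₂ - x₁, by simpa using h, by module⟩
  set c : Fin n → ℝ := fun i => if i ∈ T₁ then 1 else -1
  have hz : x₁ - x₂ = ∑ i ∈ T₁ ∪ T₂, c i • dyad (b i) := by
    rw [Finset.sum_union hdisj, sub_eq_add_neg, ← Finset.sum_neg_distrib]
    congr 1
    · exact Finset.sum_congr rfl fun i hi => by simp [c, hi]
    · exact Finset.sum_congr rfl fun i hi => by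
        simp [c, Finset.disjoint_right.1 hdisj hi]
  have hcabs : ∀ i, |c i| = 1 := fun i => by
    simp only [c]; split_ifs <;> simp
  set z := x₁ - x₂
  have hzn : ‖z‖ ^ 2 = 2 * r := by
    rw [hz, norm_sum_smul_dyad_sq, Finset.sum_congr rfl fun i _ => by rw [← sq_abs, hcabs i],
      Finset.sum_const, Finset.card_union_of_disjoint hdisj, hT₁, hT₂]
    simp; ring
  have hr0 : (0 : ℝ) < r := by exact_mod_cast hr
  have hz0 : 0 < ‖z‖ := by
    refine (norm_nonneg z).lt_of_ne fun h => ?_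
    rw [← h] at hzn
    linarith
  have hcontr : ∀ v : EuclideanSpace ℝ (Fin n), ‖v‖ = 1 → |⟪dyad v, z⟫_ℝ| ≤ 1 := by
    intro v hv
    rw [hz, inner_sum]
    refine (Finset.abs_sum_le_sum_abs _ _).trans ?_
    calc ∑ i ∈ T₁ ∪ T₂, |⟪dyad v, c i • dyad (b i)⟫_ℝ|
        = ∑ i ∈ T₁ ∪ T₂, ⟪v, b i⟫_ℝ ^ 2 := Finset.sum_congr rfl fun i _ => by
          rw [real_inner_smul_right, abs_mul, hcabs, one_mul, inner_dyad_dyad,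
            abs_of_nonneg (sq_nonneg _)]
      _ ≤ ∑ i, ⟪v, b i⟫_ℝ ^ 2 := Finset.sum_le_sum_of_subset_of_nonneg (Finset.subset_univ _)
          fun i _ _ => sq_nonneg _
      _ = 1 := by rw [b.sum_sq_inner_left, hv, one_pow]
  refine iInf₂_le_of_le z ⟨hmem, norm_pos_iff.1 hz0⟩ (iSup₂_le fun x hx => ?_)
  obtain ⟨hxS, hx0⟩ := hx
  have hxn : 0 < ‖x‖ := norm_pos_iff.2 hx0
  refine EReal.coe_le_coe_iff.2 ?_
  have hM := norm_le_toReal_modelNorm (modelNorm_lowRank_ne_top (by omega) hr (x + z))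
  set M := (modelNorm (lowRank n r) (x + z)).toReal
  have hden : ‖z‖ ≤ √(M ^ 2 - ‖x‖ ^ 2 - 2 * ⟪x, z⟫_ℝ) := by
    refine Real.le_sqrt_of_sq_le ?_
    have h1 := norm_add_sq_real x z
    have h2 : ‖x + z‖ ^ 2 ≤ M ^ 2 := pow_le_pow_left₀ (norm_nonneg _) hM 2
    linarith
  have hnum : -⟪x, z⟫_ℝ ≤ √r * ‖x‖ :=
    (neg_le_abs _).trans (abs_inner_le_of_mem_lowRank hxS hcontr)
  have hzs : ‖z‖ = √2 * √r := by
    rw [← Real.sqrt_mul (by norm_num), ← hzn, Real.sqrt_sq hz0.le]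
  rw [div_le_div_iff₀ (mul_pos hxn (hz0.trans_le hden)) (by positivity), one_mul]
  calc -⟪x, z⟫_ℝ * √2 ≤ √r * ‖x‖ * √2 := mul_le_mul_of_nonneg_right hnum (Real.sqrt_nonneg _)
    _ = ‖x‖ * ‖z‖ := by rw [hzs]; ring
    _ ≤ _ := mul_le_mul_of_nonneg_left hden hxn.le

end SymMat

/-- For symmetric matrices of rank at most `r` with `1 ≤ r < n / 2`, the nuclear norm is a
coercive continuous convex regularizer, it maximizes the sufficient RIP constant among all of
them, and the maximal value is `1 / √2`. -/
theorem mainTheorem4 (n r : ℕ) (hr : 1 ≤ r) (hrn : (r : ℝ) < (n : ℝ) / 2) :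
    (nuclearNorm : SymMat n → ℝ) ∈ regularizers (SymMat n) ∧
    suffRIP (lowRank n r) (nuclearNorm : SymMat n → ℝ) =
      ⨆ R ∈ regularizers (SymMat n), suffRIP (lowRank n r) R ∧
    suffRIP (lowRank n r) (nuclearNorm : SymMat n → ℝ) = ((1 / √2 : ℝ) : EReal) := by
  have h2 : 2 * r ≤ n := by
    have h : (2 * r : ℝ) < n := by linarith
    exact_mod_cast h.le
  have hle : ⨆ R ∈ regularizers (SymMat n), suffRIP (lowRank n r) R ≤ ((1 / √2 : ℝ) : EReal) :=
    iSup₂_le fun R _ => SymMat.suffRIP_lowRank_le hr h2 R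
  have hge := SymMat.le_suffRIP_nuclearNorm hr (show r ≤ n by omega)
  have hsup := le_iSup₂_of_le (f := fun R (_ : R ∈ regularizers (SymMat n)) =>
    suffRIP (lowRank n r) R) nuclearNorm SymMat.nuclearNorm_mem_regularizers le_rfl
  exact ⟨SymMat.nuclearNorm_mem_regularizers, le_antisymm hsup (hle.trans hge),
    le_antisymm (SymMat.suffRIP_lowRank_le hr h2 _) hge⟩
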